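/- For a positive integer $n$ let $y_n(z)=\sum_{k=0}^{n}\frac{(n+k)!}{(n-k)!\,k!}\left(\frac z2\right)^k$ be the $n$th Bessel polynomial, let $\alpha_{n1},\dots,\alpha_{nn}\in\mathbb C$ be its zeros (counted with multiplicity), and put $a_{nk}=1-\alpha_{nk}/2$, $b_{nk}=1+\alpha_{nk}/2$ for $k=1,\dots,n$. Define $$R_n(z)=\frac1{(z-1)^2}-\sum_{k=1}^n\frac{a_{nk}}{1-a_{nk}z}+\sum_{k=1}^n\frac{b_{nk}}{1-b_{nk}z}.$$ (Equivalently, $zR_n(z)=zg'(z)-\sum_{k=1}^n\big(g(a_{nk}z)-g(b_{nk}z)\big)$ for $g(z)=z/(1-z)$.) For $x\in(0,1)$ put $n_0(x)=\max\{14,\ x^2(1-x)^{-2}\}-1$. Let $x\in(0,1)$ and let $n$ be an integer with $n\ge n_0(x)$. Then $z-1$, $1-a_{nk}z$ and $1-b_{nk}z$ $(k=1,\dots,n)$ do not vanish on the circle $|z|=x$, so that $R_n$ is defined and continuous there, and $$\frac{x^{2n}}{(1-x)^{2n+2}}\,\frac{n!^2}{(2n)!^2}\ \le\ \max_{|z|=x}|R_n(z)|\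 <\ \frac{2x^{2n}}{(1-x)^{2n+2}}\,\frac{n!^2}{(2n)!^2}.$$ -/

import Mathlib

namespace BesselDiff

open scoped Nat

/-- The `n`-th Bessel polynomial
`y_n(z) = ∑_{k=0}^n (n+k)! / ((n-k)! k!) * (z/2)^k`, over `ℂ`. -/
noncomputable def besselPoly (n : ℕ) : Polynomial ℂ :=
  ∑ k ∈ Finset.range (n + 1),
    Polynomial.monomial k (((n + k)! : ℂ) / (((n - k)! : ℂ) * (k ! : ℂ)) / 2 ^ k)

/-- The zeros `α_{n1}, …, α_{nn}` of `y_n` in `ℂ`, as a multiset. -/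
noncomputable def zeros (n : ℕ) : Multiset ℂ := (besselPoly n).roots

/-- `a = 1 - α / 2`, the node factor attached to the zero `α`. -/
noncomputable def nodeA (α : ℂ) : ℂ := 1 - α / 2

/-- `b = 1 + α / 2`, the node factor attached to the zero `α`. -/
noncomputable def nodeB (α : ℂ) : ℂ := 1 + α / 2

/-- The model remainder
`R_n(z) = 1/(z-1)^2 - ∑_k a_{nk}/(1 - a_{nk} z) + ∑_k b_{nk}/(1 - b_{nk} z)`. -/
noncomputable def R (n : ℕ) (z : ℂ) : ℂ :=
  1 / (z - 1) ^ 2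
    - ((zeros n).map fun α => nodeA α / (1 - nodeA α * z)).sum
    + ((zeros n).map fun α => nodeB α / (1 - nodeB α * z)).sum

/-- `n₀(x) = max {14, x² (1-x)⁻²} - 1`. -/
noncomputable def n₀ (x : ℝ) : ℝ := max 14 (x ^ 2 / (1 - x) ^ 2) - 1

end BesselDiff

namespace BesselDiff

open Polynomial
open scoped Nat

/-! With u = z/(2(1-z)) one has 1 - az = (1-z)(1+αu) and 1 - bz = (1-z)(1-αu), so the sums in R_n
become logarithmic derivatives of F(u) = θ_n(u)θ_n(-u)'s two factors. Since θ_n(u)/θ_n(-u) is a Padé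
approximant of e^{2u}, the resulting numerator is a single monomial (`padeNumerator_eq`), and R_n(z)
= (-1)^n u^{2n} / ((1-z)^2 F(u)) (`R_eq`).

It remains to compare |F(u)| with F(0). F is even and its coefficients satisfy a two-term recurrence
(`thetaProd_coeff_succ_succ`), so F(u)/F(0) is an alternating sum in u^2. The bound n ≥ n₀(x) gives
|u|^2 ≤ (n+1)/4 on the circle, where successive term sizes at least halve. Hence |F(u)| ≤ F(0) at z
= x, where u is real (lower bound), and |F(u)| ≥ (18/25) F(0) on the whole circle (upper bound, as
25/18 < 2). This also excludes vanishing denominators. -/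

/-- The reverse Bessel polynomial `θ_n(u) = u^n y_n(1/u)`. -/
noncomputable def theta (n : ℕ) : ℂ[X] := (besselPoly n).reverse

/-! ### Coefficients and differential equations of θ_n(±u) -/

lemma besselPoly_coeff_of_le {n k : ℕ} (hk : k ≤ n) :
    (besselPoly n).coeff k = ((n + k)! : ℂ) / (((n - k)! : ℂ) * (k ! : ℂ)) / 2 ^ k := by
  rw [besselPoly, finsetSum_coeff, Finset.sum_eq_single k]
  · simp
  · intro b _ hb
    rw [coeff_monomial, if_neg hb]
  · intro h
    exact absurd (Finset.mem_range.2 (Nat.lt_succ_of_le hk)) h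

lemma besselPoly_natDegree_le (n : ℕ) : (besselPoly n).natDegree ≤ n := by
  refine natDegree_sum_le_of_forall_le _ _ fun i hi => ?_
  exact (natDegree_monomial_le _).trans (Nat.le_of_lt_succ (Finset.mem_range.1 hi))

lemma besselPoly_coeff_ne_zero {n k : ℕ} (hk : k ≤ n) : (besselPoly n).coeff k ≠ 0 := by
  rw [besselPoly_coeff_of_le hk]
  have h1 : ((n + k)! : ℂ) ≠ 0 := Nat.cast_ne_zero.2 (Nat.factorial_ne_zero _)
  have h2 : ((n - k)! : ℂ) ≠ 0 := Nat.cast_ne_zero.2 (Nat.factorial_ne_zero _)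
  have h3 : (k ! : ℂ) ≠ 0 := Nat.cast_ne_zero.2 (Nat.factorial_ne_zero _)
  exact div_ne_zero (div_ne_zero h1 (mul_ne_zero h2 h3)) (pow_ne_zero _ two_ne_zero)

lemma besselPoly_natDegree (n : ℕ) : (besselPoly n).natDegree = n :=
  le_antisymm (besselPoly_natDegree_le n)
    (le_natDegree_of_ne_zero (besselPoly_coeff_ne_zero le_rfl))

lemma theta_natDegree_le (n : ℕ) : (theta n).natDegree ≤ n :=
  (reverse_natDegree_le _).trans (besselPoly_natDegree_le n)

lemma theta_coeff_of_le {n j : ℕ} (hj : j ≤ n) :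
    (theta n).coeff j = ((2 * n - j)! : ℂ) / ((j ! : ℂ) * ((n - j)! : ℂ)) / 2 ^ (n - j) := by
  rw [theta, coeff_reverse, besselPoly_natDegree, revAt_le hj,
    besselPoly_coeff_of_le (Nat.sub_le n j), show n + (n - j) = 2 * n - j by omega,
    Nat.sub_sub_self hj]

lemma theta_coeff_top (n : ℕ) : (theta n).coeff n = 1 := by
  rw [theta_coeff_of_le le_rfl, show 2 * n - n = n by omega]
  have h : (n ! : ℂ) ≠ 0 := Nat.cast_ne_zero.2 (Nat.factorial_ne_zero _)
  simp [h]

lemma theta_coeff_zero (n : ℕ) :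
    (theta n).coeff 0 = ((2 * n)! : ℂ) / (n ! : ℂ) / 2 ^ n := by
  simp [theta_coeff_of_le (Nat.zero_le n)]

lemma theta_coeff_succ (n j : ℕ) :
    ((j : ℂ) + 1) * (j - 2 * n) * (theta n).coeff (j + 1) + 2 * (n - j) * (theta n).coeff j = 0 := by
  rcases lt_trichotomy j n with h | rfl | h
  · obtain ⟨m, rfl⟩ := Nat.exists_eq_add_of_lt h
    rw [theta_coeff_of_le h.le, theta_coeff_of_le (Nat.succ_le_of_lt h),
      show 2 * (j + m + 1) - j = (j + 2 * m + 1) + 1 by omega,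
      show 2 * (j + m + 1) - (j + 1) = j + 2 * m + 1 by omega,
      show j + m + 1 - j = m + 1 by omega, show j + m + 1 - (j + 1) = m by omega,
      Nat.factorial_succ (j + 2 * m + 1), Nat.factorial_succ j, Nat.factorial_succ m, pow_succ]
    have h2 : (m ! : ℂ) ≠ 0 := Nat.cast_ne_zero.2 (Nat.factorial_ne_zero _)
    have h3 : (j ! : ℂ) ≠ 0 := Nat.cast_ne_zero.2 (Nat.factorial_ne_zero _)
    have h4 : (j : ℂ) + 1 ≠ 0 := Nat.cast_add_one_ne_zero j
    have h5 : (m : ℂ) + 1 ≠ 0 := Nat.cast_add_one_ne_zero m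
    push_cast
    field_simp
    ring
  · rw [coeff_eq_zero_of_natDegree_lt (Nat.lt_succ_of_le (theta_natDegree_le j))]
    ring
  · rw [coeff_eq_zero_of_natDegree_lt ((theta_natDegree_le n).trans_lt h),
      coeff_eq_zero_of_natDegree_lt ((theta_natDegree_le n).trans_lt (h.trans (Nat.lt_succ_self j)))]
    ring

lemma coeff_X_mul_derivative (p : ℂ[X]) (j : ℕ) :
    (X * derivative p).coeff j = j * p.coeff j := by
  cases j with
  | zero => simp
  | succ j => rw [coeff_X_mul, coeff_derivative]; push_cast; ring

/-- The differential equation of the reverse Bessel polynomials. -/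
lemma theta_ode (n : ℕ) :
    X * derivative (derivative (theta n)) =
      2 * (X + (n : ℂ[X])) * derivative (theta n) - 2 * (n : ℂ[X]) * theta n := by
  ext j
  have h := theta_coeff_succ n j
  rw [show 2 * (X + (n : ℂ[X])) * derivative (theta n) - 2 * (n : ℂ[X]) * theta n
    = C 2 * (X * derivative (theta n)) + C (2 * (n : ℂ)) * derivative (theta n)
      - C (2 * (n : ℂ)) * theta n by simp only [map_mul, map_ofNat, map_natCast]; ring]
  rw [coeff_X_mul_derivative, coeff_sub, coeff_add, coeff_C_mul, coeff_C_mul, coeff_C_mul,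
    coeff_X_mul_derivative, coeff_derivative]
  linear_combination h

lemma coeff_comp_neg_X (p : ℂ[X]) (j : ℕ) : (p.comp (-X)).coeff j = (-1) ^ j * p.coeff j := by
  rw [show (-X : ℂ[X]) = C (-1) * X by simp, comp_C_mul_X_coeff, mul_comm]

/-- The reflected polynomial `θ_n(-u)`. -/
noncomputable def thetaNeg (n : ℕ) : ℂ[X] := (theta n).comp (-X)

lemma eval_thetaNeg (n : ℕ) (u : ℂ) : (thetaNeg n).eval u = (theta n).eval (-u) := by
  simp [thetaNeg]

lemma derivative_thetaNeg (n : ℕ) :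
    derivative (thetaNeg n) = -(derivative (theta n)).comp (-X) := by
  simp [thetaNeg, derivative_comp]

lemma thetaNeg_ode (n : ℕ) :
    X * derivative (derivative (thetaNeg n)) =
      2 * ((n : ℂ[X]) - X) * derivative (thetaNeg n) + 2 * (n : ℂ[X]) * thetaNeg n := by
  have h := congrArg (fun p : ℂ[X] => p.comp (-X)) (theta_ode n)
  simp only [mul_comp, sub_comp, add_comp, X_comp, natCast_comp, ofNat_comp] at h
  rw [derivative_thetaNeg, derivative_neg, derivative_comp, thetaNeg]
  simp only [derivative_neg, derivative_X]
  linear_combination -h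

lemma thetaNeg_natDegree_le (n : ℕ) : (thetaNeg n).natDegree ≤ n := by
  refine natDegree_comp_le.trans ?_
  simpa using theta_natDegree_le n

lemma thetaNeg_coeff (n j : ℕ) : (thetaNeg n).coeff j = (-1) ^ j * (theta n).coeff j := by
  rw [thetaNeg, coeff_comp_neg_X]

/-! ### The Padé identity -/

/-- `θ_n(u) θ_n(-u)`. -/
noncomputable def thetaProd (n : ℕ) : ℂ[X] := theta n * thetaNeg n

/-- The numerator of the logarithmic derivative of `e^{2u} θ_n(-u) / θ_n(u)`. -/
noncomputable def padeNumerator (n : ℕ) : ℂ[X] :=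
  2 * thetaProd n - derivative (theta n) * thetaNeg n + theta n * derivative (thetaNeg n)

/-- The two second-order equations eliminate all second derivatives. This Euler equation forces a
multiple of u^{2n}. -/
lemma X_mul_derivative_padeNumerator (n : ℕ) :
    X * derivative (padeNumerator n) = 2 * (n : ℂ[X]) * padeNumerator n := by
  simp only [padeNumerator, thetaProd, derivative_add, derivative_sub, derivative_mul,
    derivative_ofNat]
  linear_combination theta n * thetaNeg_ode n - thetaNeg n * theta_ode n

lemma padeNumerator_coeff_of_ne {n j : ℕ} (hj : j ≠ 2 * n) : (padeNumerator n).coeff j = 0 := by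
  have h := congrArg (fun p : ℂ[X] => p.coeff j) (X_mul_derivative_padeNumerator n)
  simp only [coeff_X_mul_derivative] at h
  rw [show 2 * (n : ℂ[X]) * padeNumerator n = C (2 * (n : ℂ)) * padeNumerator n by
      simp only [map_mul, map_ofNat, map_natCast],
    coeff_C_mul] at h
  have h' : ((j : ℂ) - 2 * n) * (padeNumerator n).coeff j = 0 := by linear_combination h
  refine (mul_eq_zero.1 h').resolve_left fun h0 => hj ?_
  exact_mod_cast sub_eq_zero.1 h0

lemma padeNumerator_coeff_two_mul (n : ℕ) : (padeNumerator n).coeff (2 * n) = 2 * (-1) ^ n := by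
  have h1 : (derivative (theta n)).coeff n = 0 := by
    rw [coeff_derivative,
      coeff_eq_zero_of_natDegree_lt (Nat.lt_succ_of_le (theta_natDegree_le n)), zero_mul]
  have h2 : (derivative (thetaNeg n)).coeff n = 0 := by
    rw [coeff_derivative,
      coeff_eq_zero_of_natDegree_lt (Nat.lt_succ_of_le (thetaNeg_natDegree_le n)), zero_mul]
  have d1 := theta_natDegree_le n
  have d2 := thetaNeg_natDegree_le n
  have d3 : (derivative (theta n)).natDegree ≤ n :=
    (natDegree_derivative_le _).trans ((Nat.sub_le _ _).trans d1)
  have d4 : (derivative (thetaNeg n)).natDegree ≤ n :=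
    (natDegree_derivative_le _).trans ((Nat.sub_le _ _).trans d2)
  rw [padeNumerator, thetaProd, ← map_ofNat (C : ℂ →+* ℂ[X]) 2, coeff_add, coeff_sub, coeff_C_mul,
    two_mul n, coeff_mul_add_eq_of_natDegree_le d1 d2, coeff_mul_add_eq_of_natDegree_le d3 d2,
    coeff_mul_add_eq_of_natDegree_le d1 d4, h1, h2, thetaNeg_coeff, theta_coeff_top]
  ring

lemma padeNumerator_eq (n : ℕ) : padeNumerator n = C (2 * (-1) ^ n) * X ^ (2 * n) := by
  ext j
  rw [coeff_C_mul, coeff_X_pow]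
  split_ifs with h
  · rw [h, padeNumerator_coeff_two_mul, mul_one]
  · rw [padeNumerator_coeff_of_ne h, mul_zero]

/-! ### Coefficients of θ_n(u)θ_n(-u) -/

lemma thetaProd_ode (n : ℕ) :
    X * derivative (X * derivative (derivative (thetaProd n))
        - 2 * (n : ℂ[X]) * derivative (thetaProd n)
        + 2 * X * (padeNumerator n - 2 * thetaProd n)) =
      (4 * (n : ℂ[X]) + 1) * (X * derivative (derivative (thetaProd n))
        - 2 * (n : ℂ[X]) * derivative (thetaProd n)
        + 2 * X * (padeNumerator n - 2 * thetaProd n))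
      - 4 * (n : ℂ[X]) * X * (padeNumerator n - 2 * thetaProd n) := by
  -- The bracket is a multiple of the product of first derivatives, so differentiating it once more
  -- closes the system.
  have key : X * derivative (derivative (thetaProd n))
        - 2 * (n : ℂ[X]) * derivative (thetaProd n)
        + 2 * X * (padeNumerator n - 2 * thetaProd n)
      = 2 * X * (derivative (theta n) * derivative (thetaNeg n)) := by
    simp only [padeNumerator, thetaProd, derivative_add, derivative_mul]
    linear_combination thetaNeg n * theta_ode n + theta n * thetaNeg_ode n
  rw [key]
  simp only [padeNumerator, thetaProd, derivative_mul, derivative_ofNat, derivative_X]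
  linear_combination 2 * X * derivative (thetaNeg n) * theta_ode n +
    2 * X * derivative (theta n) * thetaNeg_ode n

/-- Below degree 2n the Padé numerator contributes nothing, so only two coefficients remain. -/
lemma thetaProd_coeff_succ_succ {n j : ℕ} (hj : j < 2 * n) :
    ((j : ℂ) - 4 * n) * (j + 2) * (j + 1 - 2 * n) * (thetaProd n).coeff (j + 2) =
      4 * (j - 2 * n) * (thetaProd n).coeff j := by
  set E : ℂ[X] := X * derivative (derivative (thetaProd n))
        - 2 * (n : ℂ[X]) * derivative (thetaProd n)
        + 2 * X * (padeNumerator n - 2 * thetaProd n) with hE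
  have h := congrArg (fun p : ℂ[X] => p.coeff (j + 1)) (thetaProd_ode n)
  rw [← hE] at h
  simp only [coeff_X_mul_derivative] at h
  have hN : (padeNumerator n).coeff j = 0 := padeNumerator_coeff_of_ne hj.ne
  have hEj : E.coeff (j + 1) = ((j : ℂ) + 2) * (j + 1 - 2 * n) * (thetaProd n).coeff (j + 2)
      - 4 * (thetaProd n).coeff j := by
    rw [hE, show X * derivative (derivative (thetaProd n))
        - 2 * (n : ℂ[X]) * derivative (thetaProd n)
        + 2 * X * (padeNumerator n - 2 * thetaProd n)
      = X * derivative (derivative (thetaProd n)) - C (2 * (n : ℂ)) * derivative (thetaProd n)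
        + C 2 * (X * padeNumerator n) - C 4 * (X * thetaProd n) by
          simp only [map_mul, map_ofNat, map_natCast]; ring]
    simp only [coeff_sub, coeff_add, coeff_C_mul, coeff_derivative, coeff_X_mul, hN]
    push_cast
    ring
  rw [show (4 * (n : ℂ[X]) + 1) * E - 4 * (n : ℂ[X]) * X * (padeNumerator n - 2 * thetaProd n)
      = C (4 * (n : ℂ) + 1) * E - C (4 * (n : ℂ)) * (X * padeNumerator n)
        + C (8 * (n : ℂ)) * (X * thetaProd n) by
          simp only [map_mul, map_add, map_one, map_ofNat, map_natCast]; ring] at h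
  simp only [coeff_sub, coeff_add, coeff_C_mul, coeff_X_mul, hN, hEj] at h
  push_cast at h
  linear_combination h

lemma thetaProd_coeff_even_succ {n k : ℕ} (hk : k < n) :
    (thetaProd n).coeff (2 * (k + 1)) =
      -(2 * ((n : ℂ) - k) / ((2 * n - k) * (k + 1) * (2 * n - 2 * k - 1))) *
        (thetaProd n).coeff (2 * k) := by
  have h := thetaProd_coeff_succ_succ (n := n) (j := 2 * k) (by omega)
  obtain ⟨m, rfl⟩ := Nat.exists_eq_add_of_lt hk
  push_cast at h ⊢
  have e1 : 2 * ((k : ℂ) + m + 1) - k ≠ 0 := by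
    rw [show 2 * ((k : ℂ) + m + 1) - k = ((k + 2 * m + 2 : ℕ) : ℂ) by push_cast; ring]
    exact Nat.cast_ne_zero.2 (by omega)
  have e2 : (k : ℂ) + 1 ≠ 0 := Nat.cast_add_one_ne_zero k
  have e3 : 2 * ((k : ℂ) + m + 1) - 2 * k - 1 ≠ 0 := by
    rw [show 2 * ((k : ℂ) + m + 1) - 2 * k - 1 = ((2 * m + 1 : ℕ) : ℂ) by push_cast; ring]
    exact Nat.cast_ne_zero.2 (by omega)
  rw [show 2 * (k + 1) = 2 * k + 2 by ring]
  generalize (thetaProd (k + m + 1)).coeff (2 * k + 2) = a at h ⊢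
  generalize (thetaProd (k + m + 1)).coeff (2 * k) = b at h ⊢
  rw [neg_mul, div_mul_eq_mul_div, ← neg_div, eq_div_iff (mul_ne_zero (mul_ne_zero e1 e2) e3)]
  linear_combination (1 / 4) * h

lemma thetaProd_coeff_zero (n : ℕ) : (thetaProd n).coeff 0 = (theta n).coeff 0 ^ 2 := by
  rw [thetaProd, mul_coeff_zero, thetaNeg_coeff]
  ring

lemma thetaProd_coeff_odd (n k : ℕ) : (thetaProd n).coeff (2 * k + 1) = 0 := by
  have h : (thetaProd n).comp (-X) = thetaProd n := by
    rw [thetaProd, mul_comp, thetaNeg, comp_assoc, neg_comp, X_comp, neg_neg, comp_X, mul_comm]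
  have h' := congrArg (fun p : ℂ[X] => p.coeff (2 * k + 1)) h
  simp only [coeff_comp_neg_X, pow_succ, pow_mul] at h'
  norm_num at h'
  exact self_eq_neg.1 h'.symm

/-- The absolute values of the even coefficients of `θ_n(u) θ_n(-u) / θ_n(0)^2`. -/
noncomputable def prodCoeff (n : ℕ) : ℕ → ℝ
  | 0 => 1
  | k + 1 => 2 * ((n : ℝ) - k) / ((2 * n - k) * (k + 1) * (2 * n - 2 * k - 1)) * prodCoeff n k

lemma thetaProd_coeff_even {n k : ℕ} (hk : k ≤ n) :
    (thetaProd n).coeff (2 * k) = (theta n).coeff 0 ^ 2 * ((-1) ^ k * (prodCoeff n k : ℂ)) := by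
  induction k with
  | zero => simp [prodCoeff, thetaProd_coeff_zero]
  | succ k ih =>
    rw [thetaProd_coeff_even_succ hk, ih (Nat.le_of_succ_le hk), prodCoeff]
    push_cast
    ring

/-! ### Size of θ_n(u)θ_n(-u) -/

lemma prodCoeff_nonneg {n k : ℕ} (hk : k ≤ n) : 0 ≤ prodCoeff n k := by
  induction k with
  | zero => simp [prodCoeff]
  | succ k ih =>
    have h : (k : ℝ) + 1 ≤ n := by exact_mod_cast hk
    have hk0 : (0 : ℝ) ≤ k := Nat.cast_nonneg k
    rw [prodCoeff]
    refine mul_nonneg (div_nonneg (by linarith) ?_) (ih (Nat.le_of_succ_le hk))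
    exact mul_nonneg (mul_nonneg (by linarith) (by linarith)) (by linarith)

lemma prodCoeff_succ_mul_le {n k : ℕ} (hk : k < n) {v : ℝ} (hv : v ≤ ((n : ℝ) + 1) / 4) : prodCoeff n (k + 1) * v ≤ prodCoeff n k / 2 := by
  have h : (k : ℝ) + 1 ≤ n := by exact_mod_cast hk
  have hk0 : (0 : ℝ) ≤ k := Nat.cast_nonneg k
  have hp := prodCoeff_nonneg hk.le
  rw [prodCoeff]
  have hD : 0 < (2 * (n : ℝ) - k) * (k + 1) * (2 * n - 2 * k - 1) :=
    mul_pos (mul_pos (by linarith) (by linarith)) (by linarith)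
  have hq : 2 * ((n : ℝ) - k) / ((2 * n - k) * (k + 1) * (2 * n - 2 * k - 1)) * v ≤ 1 / 2 := by
    rw [div_mul_eq_mul_div, div_le_iff₀ hD]
    have h1 : (n : ℝ) + 1 ≤ (2 * n - k) * (k + 1) := by nlinarith
    have h2 : (n : ℝ) - k ≤ 2 * n - 2 * k - 1 := by linarith
    have h3 := mul_le_mul h1 h2 (by linarith) (by linarith)
    have h4 := mul_le_mul_of_nonneg_left hv (show (0 : ℝ) ≤ 2 * (n - k) by linarith)
    nlinarith
  calc _ = 2 * ((n : ℝ) - k) / ((2 * n - k) * (k + 1) * (2 * n - 2 * k - 1)) * v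
        * prodCoeff n k := by ring
    _ ≤ 1 / 2 * prodCoeff n k := mul_le_mul_of_nonneg_right hq hp
    _ = _ := by ring

lemma prodCoeff_succ_mul_pow_le {n k : ℕ} (hn : 13 ≤ n) (hk : k < n) {v : ℝ} (hv0 : 0 ≤ v)
    (hv : v ≤ ((n : ℝ) + 1) / 4) : prodCoeff n (k + 1) * v ^ (k + 1) ≤ 7 / 50 * (1 / 2) ^ k := by
  induction k with
  | zero =>
    -- The first term is at most (n+1)/(4(2n-1)), which decreases in n and equals 7/50 at n = 13.
    have h13 : (13 : ℝ) ≤ n := by exact_mod_cast hn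
    simp only [prodCoeff, Nat.cast_zero, zero_add, pow_one, pow_zero]
    rw [mul_one, mul_one, mul_one, div_mul_eq_mul_div,
      div_le_iff₀ (mul_pos (by linarith) (by linarith))]
    nlinarith
  | succ k ih =>
    have h := mul_le_mul_of_nonneg_right (prodCoeff_succ_mul_le hk hv) (pow_nonneg hv0 (k + 1))
    calc _ = prodCoeff n (k + 1 + 1) * v * v ^ (k + 1) := by ring
      _ ≤ prodCoeff n (k + 1) / 2 * v ^ (k + 1) := h
      _ = 1 / 2 * (prodCoeff n (k + 1) * v ^ (k + 1)) := by ring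
      _ ≤ 1 / 2 * (7 / 50 * (1 / 2) ^ k) := 
        mul_le_mul_of_nonneg_left (ih (Nat.lt_of_succ_lt hk)) (by norm_num)
      _ = _ := by ring

lemma sum_range_two_mul {M : Type*} [AddCommMonoid M] (f : ℕ → M) (m : ℕ) :
    ∑ j ∈ Finset.range (2 * m), f j = ∑ k ∈ Finset.range m, (f (2 * k) + f (2 * k + 1)) := by
  induction m with
  | zero => simp
  | succ m ih =>
    rw [Nat.mul_succ, Finset.sum_range_succ, Finset.sum_range_succ, ih, Finset.sum_range_succ,
      add_assoc]

lemma eval_thetaProd (n : ℕ) (u : ℂ) :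
    (thetaProd n).eval u = (theta n).coeff 0 ^ 2 *
      ∑ k ∈ Finset.range (n + 1), (-1) ^ k * ((prodCoeff n k : ℂ) * (u ^ 2) ^ k) := by
  have hdeg : (thetaProd n).natDegree < 2 * (n + 1) := by
    have := natDegree_mul_le_of_le (theta_natDegree_le n) (thetaNeg_natDegree_le n)
    rw [thetaProd]
    omega
  rw [eval_eq_sum_range' hdeg, sum_range_two_mul, Finset.mul_sum]
  refine Finset.sum_congr rfl fun k hk => ?_
  rw [thetaProd_coeff_odd, thetaProd_coeff_even (Nat.le_of_lt_succ (Finset.mem_range.1 hk)),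
    pow_mul]
  ring

lemma alternating_sum_mem_Icc (m : ℕ) : ∀ t : ℕ → ℝ, (∀ k < m + 1, 0 ≤ t k) →
    (∀ k < m, t (k + 1) ≤ t k) →
    ∑ k ∈ Finset.range (m + 1), (-1) ^ k * t k ∈ Set.Icc 0 (t 0) := by
  induction m with
  | zero => intro t h0 _; simpa using h0 0
  | succ m ih =>
    intro t h0 h1
    obtain ⟨ha, hb⟩ := ih (fun k => t (k + 1)) (fun k hk => h0 _ (by omega))
      (fun k hk => h1 _ (by omega))
    have h10 := h1 0 (Nat.succ_pos m)
    rw [Finset.sum_range_succ']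
    simp only [pow_succ, mul_neg, mul_one, neg_mul, Finset.sum_neg_distrib, pow_zero, one_mul]
    constructor <;> simp only [zero_add] at * <;> linarith

lemma norm_eval_thetaProd_ge {n : ℕ} (hn : 13 ≤ n) {u : ℂ} (hu : ‖u‖ ^ 2 ≤ ((n : ℝ) + 1) / 4) :
    18 / 25 * ‖(theta n).coeff 0‖ ^ 2 ≤ ‖(thetaProd n).eval u‖ := by
  rw [eval_thetaProd, norm_mul, norm_pow, mul_comm]
  refine mul_le_mul_of_nonneg_left ?_ (by positivity)
  rw [Finset.sum_range_succ']
  have hle : ‖∑ k ∈ Finset.range n,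
      (-1) ^ (k + 1) * ((prodCoeff n (k + 1) : ℂ) * (u ^ 2) ^ (k + 1))‖ ≤ 7 / 25 := by
    calc _ ≤ ∑ k ∈ Finset.range n, 7 / 50 * (1 / 2 : ℝ) ^ k := by
          refine norm_sum_le_of_le _ fun k hk => ?_
          have hk := Finset.mem_range.1 hk
          rw [norm_mul, norm_mul, norm_pow, norm_neg, norm_one, one_pow, one_mul, norm_pow,
            norm_pow, Complex.norm_of_nonneg (prodCoeff_nonneg hk)]
          exact prodCoeff_succ_mul_pow_le hn hk (by positivity) hu
      _ ≤ 7 / 25 := by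
          rw [← Finset.mul_sum]
          have := sum_geometric_two_le n
          linarith
  rw [pow_zero, pow_zero, show prodCoeff n 0 = 1 from rfl, Complex.ofReal_one, mul_one, mul_one]
  set S := ∑ k ∈ Finset.range n,
      (-1) ^ (k + 1) * ((prodCoeff n (k + 1) : ℂ) * (u ^ 2) ^ (k + 1))
  -- Reverse triangle inequality: |1 + S| ≥ 1 - 7/25 = 18/25.
  have := norm_sub_le (S + 1) S
  rw [add_sub_cancel_left, norm_one] at this
  linarith

lemma norm_eval_thetaProd_ofReal_le {n : ℕ} {r : ℝ} (hr : r ^ 2 ≤ ((n : ℝ) + 1) / 4) :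
    ‖(thetaProd n).eval (r : ℂ)‖ ≤ ‖(theta n).coeff 0‖ ^ 2 := by
  rw [eval_thetaProd, norm_mul, norm_pow]
  refine mul_le_of_le_one_right (by positivity) ?_
  have h := alternating_sum_mem_Icc n (fun k => prodCoeff n k * (r ^ 2) ^ k)
    (fun k hk => mul_nonneg (prodCoeff_nonneg (Nat.le_of_lt_succ hk)) (by positivity))
    (fun k hk => by
      have h1 := prodCoeff_succ_mul_le hk hr
      have h2 := prodCoeff_nonneg hk.le
      calc _ = prodCoeff n (k + 1) * r ^ 2 * (r ^ 2) ^ k := by ring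
        _ ≤ prodCoeff n k * (r ^ 2) ^ k := by gcongr; linarith)
  rw [show ∑ k ∈ Finset.range (n + 1), (-1 : ℂ) ^ k * ((prodCoeff n k : ℂ) * ((r : ℂ) ^ 2) ^ k)
    = ((∑ k ∈ Finset.range (n + 1), (-1 : ℝ) ^ k * (prodCoeff n k * (r ^ 2) ^ k) : ℝ) : ℂ) by
      push_cast; rfl, Complex.norm_of_nonneg h.1]
  simpa [prodCoeff] using h.2

/-! ### Factorization over the zeros and closed form of R_n -/

/-- `∏ (1 - α u)` over a multiset of `α`. -/
noncomputable def revProd (s : Multiset ℂ) : ℂ[X] := (s.map fun α => 1 - C α * X).prod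

lemma reverse_multiset_prod_X_sub_C (s : Multiset ℂ) :
    (s.map fun α => X - C α).prod.reverse = revProd s := by
  induction s using Multiset.induction_on with
  | empty => simpa [revProd] using reverse_C (1 : ℂ)
  | cons a s ih =>
    rw [Multiset.map_cons, Multiset.prod_cons, reverse_mul_of_domain, ih, revProd, revProd,
      Multiset.map_cons, Multiset.prod_cons]
    congr 1
    ext j
    rw [coeff_reverse, natDegree_X_sub_C]
    rcases j with _ | _ | j
    · simp [revAt_le]
    · simp [revAt_le, coeff_one]
    · rw [revAt_eq_self_of_lt (by omega)]
      simp [coeff_X, coeff_one]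

lemma theta_eq (n : ℕ) : theta n = C ((theta n).coeff 0) * revProd (zeros n) := by
  have h0 : (theta n).coeff 0 = (besselPoly n).leadingCoeff := coeff_zero_reverse _
  conv_lhs => rw [theta, (IsAlgClosed.splits (besselPoly n)).eq_prod_roots]
  rw [reverse_mul_of_domain, reverse_C, reverse_multiset_prod_X_sub_C, h0, zeros]

lemma eval_derivative_revProd (s : Multiset ℂ) (u : ℂ) (h : ∀ α ∈ s, 1 - α * u ≠ 0) :
    (derivative (revProd s)).eval u =
      -(revProd s).eval u * (s.map fun α => α / (1 - α * u)).sum := by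
  induction s using Multiset.induction_on with
  | empty => simp [revProd]
  | cons a s ih =>
    have ih := ih fun α hα => h α (Multiset.mem_cons_of_mem hα)
    have ha := h a (Multiset.mem_cons_self a s)
    have e : revProd (a ::ₘ s) = (1 - C a * X) * revProd s := by simp [revProd]
    rw [e, derivative_mul, Multiset.map_cons, Multiset.sum_cons]
    simp only [eval_add, eval_mul, ih]
    simp
    field_simp
    ring

lemma one_sub_mul_ne_zero {n : ℕ} {u : ℂ} (h : (theta n).eval u ≠ 0) :
    ∀ α ∈ zeros n, 1 - α * u ≠ 0 := by
  intro α hα h0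
  apply h
  rw [theta_eq, eval_mul, revProd, eval_multiset_prod, Multiset.prod_eq_zero, mul_zero]
  rw [Multiset.map_map]
  exact Multiset.mem_map.2 ⟨α, hα, by simp [h0]⟩

lemma eval_derivative_theta {n : ℕ} {u : ℂ} (h : (theta n).eval u ≠ 0) :
    (derivative (theta n)).eval u =
      -(theta n).eval u * ((zeros n).map fun α => α / (1 - α * u)).sum := by
  have h' := eval_derivative_revProd (zeros n) u (one_sub_mul_ne_zero h)
  conv_lhs => rw [theta_eq]
  conv_rhs => rw [theta_eq]
  rw [derivative_C_mul, eval_mul, eval_mul, h']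
  ring

/-- The Padé identity divided by 2θ_n(u)θ_n(-u), with both logarithmic derivatives expanded over the
zeros. -/
lemma sum_zeros_div_eq {n : ℕ} {u : ℂ} (h : (thetaProd n).eval u ≠ 0) :
    1 + ((zeros n).map fun α => α / (1 + α * u)).sum / 2
      + ((zeros n).map fun α => α / (1 - α * u)).sum / 2 =
      (-1) ^ n * u ^ (2 * n) / (thetaProd n).eval u := by
  have hN := congrArg (fun p : ℂ[X] => p.eval u) (padeNumerator_eq n)
  rw [thetaProd, eval_mul, eval_thetaNeg] at *
  have h1 := left_ne_zero_of_mul h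
  have h2 := right_ne_zero_of_mul h
  have d1 := eval_derivative_theta h1
  have d2 := eval_derivative_theta h2
  simp only [mul_neg, sub_neg_eq_add] at d2
  simp only [padeNumerator, thetaProd, derivative_thetaNeg, eval_add, eval_sub, eval_mul, eval_neg,
    eval_comp, eval_X, eval_C, eval_pow, eval_ofNat, eval_thetaNeg, d1, d2] at hN
  rw [eq_div_iff h]
  linear_combination hN / 2

/-- The change of variable `u = z / (2 (1 - z))`. -/
noncomputable def uVar (z : ℂ) : ℂ := z / (2 * (1 - z))

lemma one_sub_nodeA_mul {z : ℂ} (hz : 1 - z ≠ 0) (α : ℂ) :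
    1 - nodeA α * z = (1 - z) * (1 + α * uVar z) := by
  rw [nodeA, uVar]; field_simp; ring

lemma one_sub_nodeB_mul {z : ℂ} (hz : 1 - z ≠ 0) (α : ℂ) :
    1 - nodeB α * z = (1 - z) * (1 - α * uVar z) := by
  rw [nodeB, uVar]; field_simp; ring

lemma one_add_mul_ne_zero {n : ℕ} {u : ℂ} (h : (thetaProd n).eval u ≠ 0) {α : ℂ}
    (hα : α ∈ zeros n) : 1 + α * u ≠ 0 ∧ 1 - α * u ≠ 0 := by
  rw [thetaProd, eval_mul, eval_thetaNeg] at h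
  refine ⟨?_, one_sub_mul_ne_zero (left_ne_zero_of_mul h) α hα⟩
  simpa using one_sub_mul_ne_zero (right_ne_zero_of_mul h) α hα

/-- The constant 1/(1-z) is the same as in `nodeB_div`, so it cancels in R_n. -/
lemma nodeA_div {z α : ℂ} (hz : 1 - z ≠ 0) (h : 1 + α * uVar z ≠ 0) :
    nodeA α / (1 - nodeA α * z) =
      1 / (1 - z) - 1 / (2 * (1 - z) ^ 2) * (α / (1 + α * uVar z)) := by
  have e : nodeA α = 1 + α * uVar z - α / (2 * (1 - z)) := by
    rw [nodeA, uVar]; field_simp; ring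
  rw [one_sub_nodeA_mul hz]
  conv_lhs => rw [e]
  field_simp

lemma nodeB_div {z α : ℂ} (hz : 1 - z ≠ 0) (h : 1 - α * uVar z ≠ 0) :
    nodeB α / (1 - nodeB α * z) =
      1 / (1 - z) + 1 / (2 * (1 - z) ^ 2) * (α / (1 - α * uVar z)) := by
  have e : nodeB α = 1 - α * uVar z + α / (2 * (1 - z)) := by
    rw [nodeB, uVar]; field_simp; ring
  rw [one_sub_nodeB_mul hz]
  conv_lhs => rw [e]
  field_simp

/-- Closed form of the remainder. -/
lemma R_eq {n : ℕ} {z : ℂ} (hz : 1 - z ≠ 0) (h : (thetaProd n).eval (uVar z) ≠ 0) :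
    R n z = (-1) ^ n * uVar z ^ (2 * n) / ((1 - z) ^ 2 * (thetaProd n).eval (uVar z)) := by
  have hA : ((zeros n).map fun α => nodeA α / (1 - nodeA α * z)) =
      (zeros n).map fun α => 1 / (1 - z) - 1 / (2 * (1 - z) ^ 2) * (α / (1 + α * uVar z)) :=
    Multiset.map_congr rfl fun α hα => nodeA_div hz (one_add_mul_ne_zero h hα).1
  have hB : ((zeros n).map fun α => nodeB α / (1 - nodeB α * z)) =
      (zeros n).map fun α => 1 / (1 - z) + 1 / (2 * (1 - z) ^ 2) * (α / (1 - α * uVar z)) :=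
    Multiset.map_congr rfl fun α hα => nodeB_div hz (one_add_mul_ne_zero h hα).2
  have hs := sum_zeros_div_eq h
  rw [R, hA, hB, Multiset.sum_map_sub, Multiset.sum_map_add, Multiset.sum_map_mul_left,
    Multiset.sum_map_mul_left, mul_comm ((1 - z) ^ 2) (eval _ _),
    ← div_div _ (eval _ _), ← hs, show (z - 1) ^ 2 = (1 - z) ^ 2 by ring]
  generalize (Multiset.map (fun α => α / (1 + α * uVar z)) (zeros n)).sum = A
  generalize (Multiset.map (fun α => α / (1 - α * uVar z)) (zeros n)).sum = B
  field_simp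
  ring

lemma norm_R_eq {n : ℕ} {z : ℂ} (hz : 1 - z ≠ 0) (h : (thetaProd n).eval (uVar z) ≠ 0) :
    ‖R n z‖ = ‖z‖ ^ (2 * n) / ‖1 - z‖ ^ (2 * n + 2) *
      (1 / (4 ^ n * ‖(thetaProd n).eval (uVar z)‖)) := by
  have hz' : ‖1 - z‖ ≠ 0 := norm_ne_zero_iff.2 hz
  rw [R_eq hz h]
  simp only [uVar, norm_div, norm_mul, norm_pow, norm_neg, norm_one, one_pow, one_mul,
    Complex.norm_ofNat, div_pow, mul_pow]
  rw [pow_mul (2 : ℝ) 2 n, pow_add]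
  norm_num
  field_simp

/-! ### Constants and bounds on the circle -/

lemma norm_theta_coeff_zero (n : ℕ) :
    1 / (4 ^ n * ‖(theta n).coeff 0‖ ^ 2) = (n ! : ℝ) ^ 2 / ((2 * n)! : ℝ) ^ 2 := by
  have h1 : (n ! : ℝ) ≠ 0 := Nat.cast_ne_zero.2 (Nat.factorial_ne_zero _)
  have h2 : ((2 * n)! : ℝ) ≠ 0 := Nat.cast_ne_zero.2 (Nat.factorial_ne_zero _)
  rw [theta_coeff_zero]
  simp only [norm_div, norm_pow, Complex.norm_natCast, Complex.norm_ofNat, div_pow]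
  rw [← pow_mul, mul_comm n 2, pow_mul (2 : ℝ) 2 n]
  norm_num
  field_simp

lemma theta_coeff_zero_ne_zero (n : ℕ) : (theta n).coeff 0 ≠ 0 := by
  rw [theta, coeff_zero_reverse, leadingCoeff_ne_zero]
  intro h
  exact besselPoly_coeff_ne_zero (Nat.zero_le n) (by rw [h, coeff_zero])

lemma thirteen_le_of_n₀_le {x : ℝ} {n : ℕ} (hn : n₀ x ≤ n) : 13 ≤ n := by
  have h := le_max_left (14 : ℝ) (x ^ 2 / (1 - x) ^ 2)
  rw [n₀] at hn
  exact_mod_cast (show (13 : ℝ) ≤ n by linarith)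

lemma sq_div_le_of_n₀_le {x : ℝ} {n : ℕ} (hn : n₀ x ≤ n) :
    (x / (2 * (1 - x))) ^ 2 ≤ ((n : ℝ) + 1) / 4 := by
  have h := le_max_right (14 : ℝ) (x ^ 2 / (1 - x) ^ 2)
  rw [n₀] at hn
  calc _ = x ^ 2 / (1 - x) ^ 2 / 4 := by rw [div_pow, mul_pow, div_div, mul_comm]; norm_num
    _ ≤ _ := by linarith

lemma one_sub_le_norm {x : ℝ} {z : ℂ} (hz : ‖z‖ = x) : 1 - x ≤ ‖1 - z‖ := by
  have := norm_sub_norm_le (1 : ℂ) z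
  rwa [norm_one, hz] at this

lemma norm_uVar_le {x : ℝ} (hx0 : 0 < x) (hx1 : x < 1) {z : ℂ} (hz : ‖z‖ = x) :
    ‖uVar z‖ ≤ x / (2 * (1 - x)) := by
  rw [uVar, norm_div, norm_mul, Complex.norm_ofNat, hz]
  have h := one_sub_le_norm hz
  have h1 : 0 < 1 - x := by linarith
  gcongr

end BesselDiff

/-- The first conjunct says that the formula for `R n` has no vanishing denominators on the
circle `|z| = x`; the second gives the maximum of `|R n|` on it (which is attained) and its
two-sided bound. -/
theorem proposition2 (x : ℝ) (hx0 : 0 < x) (hx1 : x < 1) (n : ℕ) (hn : BesselDiff.n₀ x ≤ (n : ℝ)) :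
    (∀ z : ℂ, ‖z‖ = x → z - 1 ≠ 0 ∧ ∀ α ∈ BesselDiff.zeros n,
      1 - BesselDiff.nodeA α * z ≠ 0 ∧ 1 - BesselDiff.nodeB α * z ≠ 0) ∧
    ∃ M : ℝ, IsGreatest ((fun z : ℂ => ‖BesselDiff.R n z‖) '' {z : ℂ | ‖z‖ = x}) M ∧
      x ^ (2 * n) / (1 - x) ^ (2 * n + 2) *
          ((n.factorial : ℝ) ^ 2 / ((2 * n).factorial : ℝ) ^ 2) ≤ M ∧
      M < 2 * x ^ (2 * n) / (1 - x) ^ (2 * n + 2) *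
          ((n.factorial : ℝ) ^ 2 / ((2 * n).factorial : ℝ) ^ 2) := by
  open BesselDiff in
  have h13 := thirteen_le_of_n₀_le hn
  have hr := sq_div_le_of_n₀_le hn
  have hx : 0 < 1 - x := by linarith
  have hc : 0 < ‖(theta n).coeff 0‖ := norm_pos_iff.2 (theta_coeff_zero_ne_zero n)
  have hz1 : ∀ z : ℂ, ‖z‖ = x → 1 - z ≠ 0 := fun z hz =>
    norm_pos_iff.1 (hx.trans_le (one_sub_le_norm hz))
  have hge : ∀ z : ℂ, ‖z‖ = x →
      18 / 25 * ‖(theta n).coeff 0‖ ^ 2 ≤ ‖(thetaProd n).eval (uVar z)‖ := fun z hz =>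
    norm_eval_thetaProd_ge h13
      ((pow_le_pow_left₀ (norm_nonneg _) (norm_uVar_le hx0 hx1 hz) 2).trans hr)
  have hF : ∀ z : ℂ, ‖z‖ = x → (thetaProd n).eval (uVar z) ≠ 0 := fun z hz =>
    norm_pos_iff.1 (lt_of_lt_of_le (by positivity) (hge z hz))
  refine ⟨fun z hz => ⟨?_, fun α hα => ?_⟩, ?_⟩
  · rw [← neg_sub]
    exact neg_ne_zero.2 (hz1 z hz)
  · rw [one_sub_nodeA_mul (hz1 z hz), one_sub_nodeB_mul (hz1 z hz)]
    have h := one_add_mul_ne_zero (hF z hz) hα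
    exact ⟨mul_ne_zero (hz1 z hz) h.1, mul_ne_zero (hz1 z hz) h.2⟩
  have hxS : ‖(x : ℂ)‖ = x := Complex.norm_of_nonneg hx0.le
  have hcompact : IsCompact {z : ℂ | ‖z‖ = x} := by
    have : {z : ℂ | ‖z‖ = x} = Metric.sphere 0 x := by ext z; simp
    rw [this]
    exact isCompact_sphere 0 x
  have hu : ContinuousOn uVar {z : ℂ | ‖z‖ = x} := by
    unfold uVar
    exact continuousOn_id.div (by fun_prop) fun z hz => mul_ne_zero two_ne_zero (hz1 z hz)
  have hcont : ContinuousOn (fun z : ℂ => ‖R n z‖) {z : ℂ | ‖z‖ = x} := by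
    refine ContinuousOn.norm (ContinuousOn.congr (f := fun z : ℂ =>
      (-1) ^ n * uVar z ^ (2 * n) / ((1 - z) ^ 2 * (thetaProd n).eval (uVar z))) ?_
      fun z hz => R_eq (hz1 z hz) (hF z hz))
    refine ContinuousOn.div (by fun_prop) ?_ fun z hz =>
      mul_ne_zero (pow_ne_zero 2 (hz1 z hz)) (hF z hz)
    exact ContinuousOn.mul (by fun_prop) ((thetaProd n).continuous.comp_continuousOn hu)
  obtain ⟨M, hM⟩ := (hcompact.image_of_continuousOn hcont).exists_isGreatest
    ⟨_, (x : ℂ), hxS, rfl⟩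
  refine ⟨M, hM, ?_, ?_⟩
  -- Test point z = x: u is real and |1-z| = 1-x exactly.
  · refine le_trans ?_ (hM.2 ⟨(x : ℂ), hxS, rfl⟩)
    have hu' : uVar x = ((x / (2 * (1 - x)) : ℝ) : ℂ) := by rw [uVar]; push_cast; rfl
    have hle := norm_eval_thetaProd_ofReal_le hr
    have hpos := norm_pos_iff.2 (hF x hxS)
    have hnx : ‖(1 : ℂ) - x‖ = 1 - x := by
      rw [← Complex.ofReal_one, ← Complex.ofReal_sub, Complex.norm_of_nonneg hx.le]
    simp only
    rw [norm_R_eq (hz1 x hxS) (hF x hxS), hxS, hnx, ← norm_theta_coeff_zero]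
    rw [← hu'] at hle
    gcongr
  · obtain ⟨z, hz, rfl⟩ := hM.1
    have hz : ‖z‖ = x := hz
    have hge' := hge z hz
    have hle := one_sub_le_norm hz
    simp only
    rw [norm_R_eq (hz1 z hz) (hF z hz), hz, ← norm_theta_coeff_zero]
    calc _ ≤ x ^ (2 * n) / (1 - x) ^ (2 * n + 2) *
          (1 / (4 ^ n * (18 / 25 * ‖(theta n).coeff 0‖ ^ 2))) := by gcongr
      _ = 25 / 18 * (x ^ (2 * n) / (1 - x) ^ (2 * n + 2) *
          (1 / (4 ^ n * ‖(theta n).coeff 0‖ ^ 2))) := by field_simp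
      _ < 2 * (x ^ (2 * n) / (1 - x) ^ (2 * n + 2) *
          (1 / (4 ^ n * ‖(theta n).coeff 0‖ ^ 2))) := by gcongr; norm_num
      _ = _ := by ring
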